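/- Let $\mathcal B$ be a real topological vector space with continuous dual $\mathcal B^\star$, and let $\mathcal W\subset\mathcal B$ and $\mathcal X\subset\mathcal B^\star$ be nonempty, convex and centrally symmetric. For a set $\mathcal K$ let $\|v\|_{\mathcal K}=\inf\{\alpha>0: v\in\alpha\mathcal K\}\in[0,\infty]$ be its Minkowski functional, and let $\mathcal W^\star=\{x\in\mathcal B^\star: |\langle x,w\rangle|\le 1\ \text{for all } w\in\mathcal W\}$. Let $F$ be the class of linear cost functions $w\mapsto\langle x,w\rangle$ on $\mathcal W$ with $x\in\mathcal X$. An online learning algorithm is a map $\mathcal A:\bigcup_{n\ge1}F^{n-1}\to\mathcal W$. For $n\ge 1$ the value of the $n$-round game is $$\mathcal V_n(\mathcal W,\mathcal X)=\inf_{\mathcal A}\ \sup_{f_1,\dots,f_n\in F}\left\{\frac1n\sum_{t=1}^n f_t\big(\mathcal A(f_1,\dots,f_{t-1})\big)-\inf_{w\in\mathcal W}\frac1n\sum_{t=1}^n f_t(w)\right\},$$ and for $p\in[1,2]$ the value rate constant is $$V_p=\inf\left\{V\ \middle|\ \forall n\ge1:\ \mathcal V_n(\mathcal W,\mathcal X)\le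 V\,n^{-(1-\frac1p)}\right\},\qquad \inf\emptyset=\infty .$$ Let $\epsilon=(\epsilon_i)_{i\ge1}$ be independent uniform random signs. For $r>0$ let the martingale-type constant $C_r$ of the pair $(\mathcal W^\star,\mathcal X)$ be the infimum (with $\inf\emptyset=\infty$) of all $C\in[0,\infty)$ such that for all $x_0\in\mathcal B^\star$ and all sequences of mappings $x_n:\{\pm1\}^{n-1}\to\mathcal B^\star$ $(n\ge1)$, with $x_n(\epsilon)=x_n(\epsilon_1,\dots,\epsilon_{n-1})$, $$\sup_n \mathbb E\Big\|x_0+\sum_{i=1}^n\epsilon_i x_i(\epsilon)\Big\|_{\mathcal W^\star}^{r}\le C^{r}\Big(\|x_0\|_{\mathcal X}^{r}+\sum_{n\ge1}\mathbb E\|x_n(\epsilon)\|_{\mathcal X}^{r}\Big).$$ Then for every $p\in[1,2]$ and every $p'$ with $0<p'<p$, $$C_{p'}\le\frac{1104\,V_p}{(p-p')^2}.$$ -/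

import Mathlib

open scoped ENNReal NNReal Pointwise

noncomputable section

/-! ### The online convex learning game -/

/-- The average regret of an online learning algorithm `A` against the cost functions
`f 0, …, f (n - 1)` on the set `W`.  In round `t` the learner has seen `f 0, …, f (t - 1)`.
The value is an extended real because the infimum over `W` may be `-∞`. -/
def regret {B : Type*} {W : Set B} {F : Set (W → ℝ)} (A : (m : ℕ) → (Fin m → F) → W)
    {n : ℕ} (f : Fin n → F) : EReal :=
  (((1 / n : ℝ) * ∑ t : Fin n,
      (f t : W → ℝ) (A t (fun i => f (Fin.castLE t.isLt.le i))) : ℝ) : EReal)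
    - ⨅ w : W, (((1 / n : ℝ) * ∑ t : Fin n, (f t : W → ℝ) w : ℝ) : EReal)

/-- The value of the `n`-round game: the best worst-case regret over all algorithms. -/
def gameValue {B : Type*} {W : Set B} (F : Set (W → ℝ)) (n : ℕ) : EReal :=
  ⨅ A : (m : ℕ) → (Fin m → F) → W, ⨆ f : Fin n → F, regret A f

/-- The class of linear cost functions `w ↦ ⟨x, w⟩` on `W`, with `x ∈ X`. -/
def linearCosts {B : Type*} [AddCommGroup B] [Module ℝ B] [TopologicalSpace B]
    (W : Set B) (X : Set (StrongDual ℝ B)) : Set (W → ℝ) :=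
  {f | ∃ x ∈ X, f = fun w : W => x (w : B)}

/-- The value rate constant `V_p` of `(W, X)`: the infimum of all `V` such that the value of
the `n`-round linear game is at most `V * n ^ (-(1 - 1 / p))` for every `n ≥ 1`; it is `∞` if
there is no such `V`.  Only `V ≥ 0` can occur, because the value is nonnegative
(`gameValue_linearCosts_nonneg`). -/
def valueRateConst {B : Type*} [AddCommGroup B] [Module ℝ B] [TopologicalSpace B]
    (W : Set B) (X : Set (StrongDual ℝ B)) (p : ℝ) : ℝ≥0∞ :=
  ⨅ (V : ℝ≥0) (_ : ∀ n : ℕ, 1 ≤ n →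
    gameValue (linearCosts W X) n ≤ (((V : ℝ) * (n : ℝ) ^ (-(1 - 1 / p)) : ℝ) : EReal)),
    (V : ℝ≥0∞)

/-! ### Martingale type of a pair of sets -/

/-- Expectation of a nonnegative function of `n` independent uniform signs. -/
def signExpect {n : ℕ} (g : (Fin n → ℤˣ) → ℝ≥0∞) : ℝ≥0∞ :=
  (∑ ε : Fin n → ℤˣ, g ε) / 2 ^ n

/-- The Walsh-Paley martingale `x₀ + ∑_{i < n} ε_i x_i(ε_0, …, ε_{i-1})`.  Indices of the signs
and of the sequence `x` start at `0`, so that `x i` depends on exactly `i` signs. -/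
def walshPaley {E : Type*} [AddCommGroup E] (x₀ : E) (x : (i : ℕ) → (Fin i → ℤˣ) → E)
    (n : ℕ) (ε : Fin n → ℤˣ) : E :=
  x₀ + ∑ i : Fin n, ε i • x i (fun j => ε (Fin.castLE i.isLt.le j))

/-- The martingale type inequality with exponent `p` and constant `C` for the pair `(K, X)`.
The functional `egauge ℝ K` is the Minkowski functional of a convex symmetric set `K`, with values
in `[0, ∞]` (see `egauge_eq_minkowski`). -/
def MTypeIneq {E : Type*} [AddCommGroup E] [Module ℝ E] (K X : Set E) (p : ℝ) (C : ℝ≥0) : Prop :=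
  ∀ (x₀ : E) (x : (i : ℕ) → (Fin i → ℤˣ) → E),
    ⨆ n : ℕ, signExpect (fun ε : Fin n → ℤˣ => egauge ℝ K (walshPaley x₀ x n ε) ^ p) ≤
      (C : ℝ≥0∞) ^ p *
        (egauge ℝ X x₀ ^ p + ∑' i : ℕ, signExpect (fun ε : Fin i → ℤˣ => egauge ℝ X (x i ε) ^ p))

/-- The martingale type constant `C_p` of the pair `(K, X)`; it is `∞` if the martingale type
inequality holds for no finite constant. -/
def martingaleTypeConst {E : Type*} [AddCommGroup E] [Module ℝ E] (K X : Set E) (p : ℝ) : ℝ≥0∞ :=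
  ⨅ (C : ℝ≥0) (_ : MTypeIneq K X p C), (C : ℝ≥0∞)

end

/-! ### Sanity facts -/

theorem zero_mem_of_convex_symm {E : Type*} [AddCommGroup E] [Module ℝ E] {K : Set E}
    (hne : K.Nonempty) (hc : Convex ℝ K) (hs : ∀ v ∈ K, -v ∈ K) : (0 : E) ∈ K := by
  obtain ⟨v, hv⟩ := hne
  have h := hc hv (hs v hv) (by norm_num : (0 : ℝ) ≤ 1 / 2) (by norm_num : (0 : ℝ) ≤ 1 / 2)
    (by norm_num)
  simpa using h

theorem egauge_eq_minkowski {E : Type*} [AddCommGroup E] [Module ℝ E] {K : Set E}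
    (hne : K.Nonempty) (hc : Convex ℝ K) (hs : ∀ v ∈ K, -v ∈ K) (v : E) :
    egauge ℝ K v = ⨅ (a : ℝ) (_ : 0 < a) (_ : v ∈ a • K), ENNReal.ofReal a := by
  have h0 := zero_mem_of_convex_symm hne hc hs
  apply le_antisymm
  · refine le_iInf fun a => le_iInf fun ha => le_iInf fun hv => ?_
    refine (iInf₂_le a hv).trans ?_
    rw [Real.enorm_eq_ofReal ha.le]
  · refine le_iInf₂ fun c hv => ?_
    rcases lt_trichotomy c 0 with hc0 | hc0 | hc0
    · refine (iInf₂_le (-c) (neg_pos.2 hc0)).trans ((iInf_le _ ?_).trans ?_)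
      · obtain ⟨k, hk, rfl⟩ := hv
        exact ⟨-k, hs k hk, by simp⟩
      · rw [← enorm_neg, Real.enorm_eq_ofReal (neg_pos.2 hc0).le]
    · subst hc0
      have hv0 : v = 0 := by
        obtain ⟨k, -, rfl⟩ := hv
        simp
      subst hv0
      refine ENNReal.le_of_forall_pos_le_add fun e he _ => ?_
      refine (iInf₂_le (e : ℝ) (by exact_mod_cast he)).trans ((iInf_le _ ?_).trans ?_)
      · exact ⟨0, h0, by simp⟩
      · simp
    · refine (iInf₂_le c hc0).trans ((iInf_le _ hv).trans ?_)
      rw [Real.enorm_eq_ofReal hc0.le]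

theorem gameValue_linearCosts_nonneg {B : Type*} [AddCommGroup B] [Module ℝ B]
    [TopologicalSpace B] {W : Set B} {X : Set (StrongDual ℝ B)} (hW : W.Nonempty)
    (hX : (0 : StrongDual ℝ B) ∈ X) (n : ℕ) : 0 ≤ gameValue (linearCosts W X) n := by
  refine le_iInf fun A => ?_
  have : Nonempty W := hW.to_subtype
  let z : linearCosts W X := ⟨fun _ => 0, 0, hX, by simp⟩
  refine le_trans ?_ (le_iSup _ (fun _ => z))
  simp [regret, z]

/-! ### Expectations over signs -/

/-! Let N be the Minkowski functional of the polar of `W` and M that of `X`. An adversary who picks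
a cost or its negative in each round forces total regret up to the largest mean of N over
Walsh-Paley walks of n steps in `X` (`exists_costs_of_lt_walkValue`), so this mean is at most V
n^(1/p) for every admissible rate constant V (`walkValue_le_of_gameValue_le`). This controls only
walks whose steps have M at most 1.

To pass to arbitrary steps, fix q < p and consider paths with ∑ M^q ≤ σ^q. Sort the increments by
dyadic size σ 2^(-k): at most 2^(kq) of them have level k, so level k contributes about σ 2^(-k) V
2^(kq/p). The resulting geometric series converges because q < p, and gives the weak-type maximal
inequality `mul_signProb_walkMax_zero_le` with one factor 1/(p - q).

A good-λ argument (`signProb_walkMax_good_lambda`) turns it into a q-th moment bound with constant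
512 V / (p - q) when q ≥ 1 (`signExpect_rpow_walshPaley_le`). When q < 1, subadditivity of t ↦ t^q
already gives the constant V (`rpow_walshPaley_le`). Both are below 1104 V / (p - q)^2. -/

theorem signExpect_zero (g : (Fin 0 → ℤˣ) → ℝ≥0∞) : signExpect g = g ![] := by
  simp [signExpect, Matrix.empty_eq]

theorem signExpect_succ {n : ℕ} (g : (Fin (n + 1) → ℤˣ) → ℝ≥0∞) :
    signExpect g = (signExpect (fun ε : Fin n → ℤˣ => g (Fin.cons 1 ε)) +
      signExpect (fun ε : Fin n → ℤˣ => g (Fin.cons (-1) ε))) / 2 := by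
  have h : ∑ ε : Fin (n + 1) → ℤˣ, g ε =
      ∑ ε : Fin n → ℤˣ, g (Fin.cons 1 ε) + ∑ ε : Fin n → ℤˣ, g (Fin.cons (-1) ε) := by
    rw [← (Fin.consEquiv (fun _ : Fin (n + 1) => ℤˣ)).sum_comp, Fintype.sum_prod_type]
    have : (Finset.univ : Finset ℤˣ) = {1, -1} := rfl
    rw [this, Finset.sum_pair (by decide)]
    rfl
  rw [signExpect, h, signExpect, signExpect, ← ENNReal.add_div, pow_succ, ENNReal.div_eq_inv_mul,
    ENNReal.div_eq_inv_mul, ENNReal.div_eq_inv_mul, ENNReal.mul_inv (by simp) (by simp)]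
  ring

theorem signExpect_mono {n : ℕ} {g h : (Fin n → ℤˣ) → ℝ≥0∞} (H : ∀ ε, g ε ≤ h ε) :
    signExpect g ≤ signExpect h :=
  ENNReal.div_le_div_right (Finset.sum_le_sum fun ε _ => H ε) _

theorem signExpect_const (n : ℕ) (c : ℝ≥0∞) : signExpect (fun _ : Fin n → ℤˣ => c) = c := by
  rw [signExpect, Finset.sum_const, Finset.card_univ, Fintype.card_fun, Fintype.card_fin,
    Fintype.card_units_int, nsmul_eq_mul, mul_comm]
  push_cast
  exact ENNReal.mul_div_cancel_right (by simp) (by simp)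

theorem signExpect_add {n : ℕ} (g h : (Fin n → ℤˣ) → ℝ≥0∞) :
    signExpect (fun ε => g ε + h ε) = signExpect g + signExpect h := by
  rw [signExpect, Finset.sum_add_distrib, ENNReal.add_div]; rfl

theorem signExpect_const_mul {n : ℕ} (c : ℝ≥0∞) (g : (Fin n → ℤˣ) → ℝ≥0∞) :
    signExpect (fun ε => c * g ε) = c * signExpect g := by
  rw [signExpect, ← Finset.mul_sum, mul_div_assoc]; rfl

theorem ne_top_of_signExpect_ne_top {n : ℕ} {g : (Fin n → ℤˣ) → ℝ≥0∞} (h : signExpect g ≠ ∞)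
    (ε : Fin n → ℤˣ) : g ε ≠ ∞ := by
  intro hε
  apply h
  rw [signExpect, (ENNReal.sum_eq_top).2 ⟨ε, Finset.mem_univ _, hε⟩]
  exact ENNReal.top_div_of_ne_top (by simp)

/-- The uniform probability of a set of sign vectors. -/
noncomputable def signProb {n : ℕ} (A : Set (Fin n → ℤˣ)) : ℝ≥0∞ :=
  signExpect (A.indicator 1)

theorem signProb_mono {n : ℕ} {A A' : Set (Fin n → ℤˣ)} (h : A ⊆ A') :
    signProb A ≤ signProb A' :=
  signExpect_mono fun ε => Set.indicator_le_indicator_of_subset h (fun _ => zero_le) ε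

theorem signProb_univ (n : ℕ) : signProb (Set.univ : Set (Fin n → ℤˣ)) = 1 := by
  rw [signProb, Set.indicator_univ]; exact signExpect_const n 1

theorem signProb_le_one {n : ℕ} (A : Set (Fin n → ℤˣ)) : signProb A ≤ 1 :=
  (signProb_mono (Set.subset_univ A)).trans (signProb_univ n).le

theorem signProb_empty (n : ℕ) : signProb (∅ : Set (Fin n → ℤˣ)) = 0 := by
  rw [signProb, Set.indicator_empty]; exact signExpect_const n 0

theorem signProb_eq_zero {n : ℕ} {A : Set (Fin n → ℤˣ)} (h : ∀ ε, ε ∉ A) : signProb A = 0 := by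
  rw [Set.eq_empty_of_forall_notMem h, signProb_empty]

theorem signProb_succ {n : ℕ} (A : Set (Fin (n + 1) → ℤˣ)) :
    signProb A = (signProb {ε : Fin n → ℤˣ | Fin.cons 1 ε ∈ A} +
      signProb {ε : Fin n → ℤˣ | Fin.cons (-1) ε ∈ A}) / 2 := by
  rw [signProb, signExpect_succ]; rfl

/-- The uniform measure on sign vectors. -/
noncomputable def signMeasure (n : ℕ) : @MeasureTheory.Measure (Fin n → ℤˣ) ⊤ :=
  letI : MeasurableSpace (Fin n → ℤˣ) := ⊤
  (2 ^ n : ℝ≥0∞)⁻¹ • MeasureTheory.Measure.count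

theorem lintegral_signMeasure {n : ℕ} (g : (Fin n → ℤˣ) → ℝ≥0∞) :
    @MeasureTheory.lintegral _ ⊤ (signMeasure n) g = signExpect g := by
  let : MeasurableSpace (Fin n → ℤˣ) := ⊤
  have : MeasurableSingletonClass (Fin n → ℤˣ) := ⟨fun _ => trivial⟩
  rw [signMeasure, MeasureTheory.lintegral_smul_measure, MeasureTheory.lintegral_count,
    tsum_fintype, signExpect, smul_eq_mul, ENNReal.div_eq_inv_mul]

theorem signMeasure_apply {n : ℕ} (A : Set (Fin n → ℤˣ)) :
    @DFunLike.coe _ _ _ (@MeasureTheory.Measure.instFunLike _ ⊤) (signMeasure n) A =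
      signProb A := by
  let : MeasurableSpace (Fin n → ℤˣ) := ⊤
  rw [signProb, ← lintegral_signMeasure, MeasureTheory.lintegral_indicator_one MeasurableSpace.measurableSet_top]

/-! ### The good-λ inequality -/

/-- If f > 2t, then either g ≤ δt, where the hypothesis applies, or g > δt. Integrating this union
bound against q t^(q-1) gives the claim by the layer-cake formula. The f-term is not absorbed here,
since that needs its finiteness. -/
theorem lintegral_rpow_le_of_good_lambda {Ω : Type*} [MeasurableSpace Ω]
    {μ : MeasureTheory.Measure Ω} {f g : Ω → ℝ} (hf0 : ∀ ω, 0 ≤ f ω) (hg0 : ∀ ω, 0 ≤ g ω)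
    (hf : Measurable f) (hg : Measurable g) {q δ : ℝ} (hq : 0 < q) (hδ : 0 < δ) {θ : ℝ≥0∞}
    (H : ∀ t : ℝ, 0 < t → μ {ω | 2 * t < f ω ∧ g ω ≤ δ * t} ≤ θ * μ {ω | t < f ω}) :
    ∫⁻ ω, ENNReal.ofReal ((f ω / 2) ^ q) ∂μ ≤
      θ * ∫⁻ ω, ENNReal.ofReal (f ω ^ q) ∂μ + ∫⁻ ω, ENNReal.ofReal ((g ω / δ) ^ q) ∂μ := by
  have lc : ∀ h : Ω → ℝ, (∀ ω, 0 ≤ h ω) → Measurable h → ∫⁻ ω, ENNReal.ofReal (h ω ^ q) ∂μ =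
      ENNReal.ofReal q *
        ∫⁻ t in Set.Ioi (0 : ℝ), μ {ω | t < h ω} * ENNReal.ofReal (t ^ (q - 1)) :=
    fun h h0 hm => MeasureTheory.lintegral_rpow_eq_lintegral_meas_lt_mul μ
      (Filter.Eventually.of_forall h0) hm.aemeasurable hq
  have hmeas : ∀ h : Ω → ℝ, Measurable fun t : ℝ => μ {ω | t < h ω} * ENNReal.ofReal (t ^ (q - 1)) := by
    intro h
    have h1 : Measurable fun t : ℝ => μ {ω | t < h ω} :=
      Antitone.measurable fun s t hst => MeasureTheory.measure_mono fun ω hω => lt_of_le_of_lt hst hω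
    exact h1.mul (by fun_prop)
  rw [lc (fun ω => f ω / 2) (fun ω => by have := hf0 ω; positivity) (hf.div_const _), lc f hf0 hf,
    lc (fun ω => g ω / δ) (fun ω => div_nonneg (hg0 ω) hδ.le) (hg.div_const _),
    mul_left_comm θ, ← mul_add]
  gcongr
  rw [← MeasureTheory.lintegral_const_mul _ (hmeas f),
    ← MeasureTheory.lintegral_add_right _ (hmeas _)]
  refine MeasureTheory.setLIntegral_mono_ae' measurableSet_Ioi
    (Filter.Eventually.of_forall fun t ht => ?_)
  rw [← mul_assoc, ← add_mul]
  gcongr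
  refine le_trans (MeasureTheory.measure_mono ?_)
    ((MeasureTheory.measure_union_le _ _).trans (add_le_add (H t ht) le_rfl))
  intro ω (hω : t < f ω / 2)
  by_cases h : g ω ≤ δ * t
  · exact Or.inl ⟨by linarith, h⟩
  · right
    change t < g ω / δ
    rw [lt_div_iff₀ hδ]; linarith

/-! ### Trees of vectors and walks along them -/

/-- The subtree of `x` below the first sign `s`. -/
def treeShift {E : Type*} (x : (i : ℕ) → (Fin i → ℤˣ) → E) (s : ℤˣ) :
    (i : ℕ) → (Fin i → ℤˣ) → E :=
  fun i δ => x (i + 1) (Fin.cons s δ)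

/-- The maximum of `N` along the first `n` steps of the walk `x` from `v`. -/
def walkMax {E : Type*} [AddCommGroup E] (N : E → ℝ≥0∞) :
    (n : ℕ) → E → ((i : ℕ) → (Fin i → ℤˣ) → E) → (Fin n → ℤˣ) → ℝ≥0∞
  | 0, v, _, _ => N v
  | n + 1, v, x, ε =>
    max (N v) (walkMax N n (v + ε 0 • x 0 ![]) (treeShift x (ε 0)) (Fin.tail ε))

/-- The sum of `g` over the first `n` increments of the tree `x`. -/
def walkSum {E : Type*} (g : E → ℝ≥0∞) :
    (n : ℕ) → ((i : ℕ) → (Fin i → ℤˣ) → E) → (Fin n → ℤˣ) → ℝ≥0∞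
  | 0, _, _ => 0
  | n + 1, x, ε => g (x 0 ![]) + walkSum g n (treeShift x (ε 0)) (Fin.tail ε)

/-- The largest expectation of `N` after `m` steps in `X` from `d`. -/
noncomputable def walkValue {E : Type*} [AddCommGroup E] (N : E → ℝ≥0∞) (X : Set E) : ℕ → E → ℝ≥0∞
  | 0, d => N d
  | m + 1, d => ⨆ x ∈ X, (walkValue N X m (d + x) + walkValue N X m (d - x)) / 2

theorem walkSum_cons {E : Type*} (g : E → ℝ≥0∞) (n : ℕ) (x : (i : ℕ) → (Fin i → ℤˣ) → E) (s : ℤˣ)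
    (ε : Fin n → ℤˣ) : walkSum g (n + 1) x (Fin.cons s ε) =
      g (x 0 ![]) + walkSum g n (treeShift x s) ε := by
  simp [walkSum]

theorem signExpect_walkSum {E : Type*} (g : E → ℝ≥0∞) (n : ℕ) (x : (i : ℕ) → (Fin i → ℤˣ) → E) :
    signExpect (walkSum g n x) =
      ∑ i ∈ Finset.range n, signExpect (fun ε : Fin i → ℤˣ => g (x i ε)) := by
  induction n generalizing x with
  | zero => simp [walkSum, signExpect]
  | succ n ih =>
    rw [signExpect_succ, Finset.sum_range_succ']
    simp only [walkSum_cons, signExpect_add, signExpect_const]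
    rw [ih, ih, signExpect_zero]
    have h : ∀ i : ℕ, signExpect (fun ε : Fin (i + 1) → ℤˣ => g (x (i + 1) ε)) =
        (signExpect (fun ε : Fin i → ℤˣ => g (treeShift x 1 i ε)) +
          signExpect (fun ε : Fin i → ℤˣ => g (treeShift x (-1) i ε))) / 2 :=
      fun i => signExpect_succ _
    simp only [h, div_eq_mul_inv, ← Finset.sum_mul, Finset.sum_add_distrib]
    rw [add_add_add_comm, add_mul, ← two_mul, mul_right_comm,
      ENNReal.mul_inv_cancel (by simp) (by simp), one_mul, add_comm]

section

variable {E : Type*} [AddCommGroup E]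

theorem walkMax_cons (N : E → ℝ≥0∞) (n : ℕ) (v : E) (x : (i : ℕ) → (Fin i → ℤˣ) → E) (s : ℤˣ)
    (ε : Fin n → ℤˣ) : walkMax N (n + 1) v x (Fin.cons s ε) =
      max (N v) (walkMax N n (v + s • x 0 ![]) (treeShift x s) ε) := by
  simp [walkMax]

/-- Absorbing the first step into the starting point lets every later induction peel the tree at its
root. -/
theorem walshPaley_succ (v : E) (x : (i : ℕ) → (Fin i → ℤˣ) → E) (n : ℕ)
    (ε : Fin (n + 1) → ℤˣ) : walshPaley v x (n + 1) ε =
      walshPaley (v + ε 0 • x 0 ![]) (treeShift x (ε 0)) n (Fin.tail ε) := by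
  rw [walshPaley, walshPaley, Fin.sum_univ_succ, ← add_assoc]
  congr 1
  · congr 3
    exact funext fun j => absurd j.2 (by simp)
  · refine Finset.sum_congr rfl fun i _ => ?_
    rw [treeShift]
    congr 2
    funext j
    refine Fin.cases ?_ (fun j => ?_) j <;> rfl

theorem le_walkMax (N : E → ℝ≥0∞) (n : ℕ) (v : E) (x : (i : ℕ) → (Fin i → ℤˣ) → E)
    (ε : Fin n → ℤˣ) : N v ≤ walkMax N n v x ε := by
  cases n with
  | zero => exact le_rfl
  | succ n => exact le_max_left _ _

theorem walshPaley_le_walkMax (N : E → ℝ≥0∞) (n : ℕ) (v : E) (x : (i : ℕ) → (Fin i → ℤˣ) → E)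
    (ε : Fin n → ℤˣ) : N (walshPaley v x n ε) ≤ walkMax N n v x ε := by
  induction n generalizing v x with
  | zero => simp [walshPaley, walkMax]
  | succ n ih =>
    rw [walshPaley_succ]
    exact (ih _ _ _).trans (le_max_right _ _)

theorem walkMax_add_le {N : E → ℝ≥0∞} (hN : ∀ v w, N (v + w) ≤ N v + N w) (n : ℕ) (u v : E)
    (x : (i : ℕ) → (Fin i → ℤˣ) → E) (ε : Fin n → ℤˣ) :
    walkMax N n (u + v) x ε ≤ N u + walkMax N n v x ε := by
  induction n generalizing v x with
  | zero => exact hN u v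
  | succ n ih =>
    refine max_le ((hN u v).trans (by gcongr; exact le_max_left _ _)) ?_
    rw [add_assoc]
    exact (ih _ _ _).trans (by gcongr; exact le_max_right _ _)

theorem apply_sign_smul {N : E → ℝ≥0∞} (hN : ∀ v, N (-v) = N v) (s : ℤˣ) (v : E) :
    N (s • v) = N v := by
  rcases Int.units_eq_one_or s with rfl | rfl
  · rw [one_smul]
  · rw [Units.neg_smul, one_smul, hN]

theorem walkMax_ne_top {N M : E → ℝ≥0∞} (hN : ∀ v w, N (v + w) ≤ N v + N w)
    (hneg : ∀ v, N (-v) = N v) {V : ℝ≥0} (hNM : ∀ v, N v ≤ V * M v) {q : ℝ} (hq : 0 < q)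
    (n : ℕ) (v : E) (hv : N v ≠ ∞) (x : (i : ℕ) → (Fin i → ℤˣ) → E) (ε : Fin n → ℤˣ)
    (hx : walkSum (fun y => M y ^ q) n x ε ≠ ∞) : walkMax N n v x ε ≠ ∞ := by
  induction n generalizing v x with
  | zero => exact hv
  | succ n ih =>
    rw [walkSum, ENNReal.add_ne_top] at hx
    refine (max_lt hv.lt_top (ih _ ?_ _ _ hx.2).lt_top).ne
    refine ((hN _ _).trans_lt (ENNReal.add_lt_top.2 ⟨hv.lt_top, ?_⟩)).ne
    rw [apply_sign_smul hneg]
    refine (hNM _).trans_lt (ENNReal.mul_lt_top ENNReal.coe_lt_top ?_)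
    rw [lt_top_iff_ne_top]
    intro h
    exact hx.1 (by rw [h, ENNReal.top_rpow_of_pos hq])

/-- For q ≤ 1 the map t ↦ t^q is subadditive, so the bound holds path by path, without cancellation.
-/
theorem rpow_walshPaley_le {N M : E → ℝ≥0∞} (hN : ∀ v w, N (v + w) ≤ N v + N w)
    (hneg : ∀ v, N (-v) = N v) {V : ℝ≥0} (hNM : ∀ v, N v ≤ V * M v) {q : ℝ} (hq : 0 < q)
    (hq1 : q ≤ 1) (n : ℕ) (v : E) (x : (i : ℕ) → (Fin i → ℤˣ) → E) (ε : Fin n → ℤˣ) :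
    N (walshPaley v x n ε) ^ q ≤ N v ^ q + (V : ℝ≥0∞) ^ q * walkSum (fun y => M y ^ q) n x ε := by
  induction n generalizing v x with
  | zero => simp [walshPaley, walkSum]
  | succ n ih =>
    rw [walshPaley_succ, walkSum, mul_add, ← add_assoc]
    refine (ih _ _ _).trans ?_
    gcongr
    refine (ENNReal.rpow_le_rpow (hN _ _) hq.le).trans
      ((ENNReal.rpow_add_le_add_rpow _ _ hq.le hq1).trans ?_)
    gcongr
    rw [apply_sign_smul hneg, ← ENNReal.mul_rpow_of_nonneg _ _ hq.le]
    exact ENNReal.rpow_le_rpow (hNM _) hq.le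

theorem le_walkValue (N : E → ℝ≥0∞) {X : Set E} (hX : 0 ∈ X) (m : ℕ) (d : E) :
    N d ≤ walkValue N X m d := by
  induction m with
  | zero => exact le_rfl
  | succ m ih =>
    refine le_trans ?_ (le_iSup₂ (f := fun x (_ : x ∈ X) =>
      (walkValue N X m (d + x) + walkValue N X m (d - x)) / 2) 0 hX)
    simp only [add_zero, sub_zero]
    rw [ENNReal.add_div, ENNReal.add_halves]
    exact ih

end

/-! ### A maximal inequality -/

theorem apply_finsupp_sum_le {E : Type*} [AddCommGroup E] [Module ℝ E] {N : E → ℝ≥0∞}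
    (hN0 : N 0 = 0) (hN : ∀ v w, N (v + w) ≤ N v + N w)
    (hsmul : ∀ (t : ℝ) v, 0 ≤ t → N (t • v) ≤ ENNReal.ofReal t * N v) {τ : ℕ → ℝ}
    (hτ : ∀ k, 0 < τ k) (c : ℕ →₀ E) :
    N (c.sum fun k y => (2 * τ k) • y) ≤ ∑' k, ENNReal.ofReal (2 * τ k) * N (c k) := by
  refine le_trans ?_ (ENNReal.sum_le_tsum c.support)
  refine (Finset.le_sum_of_subadditive N hN0.le hN _ _).trans ?_
  exact Finset.sum_le_sum fun k _ => hsmul _ _ (by have := hτ k; positivity)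

/-- The right side is a potential that dominates N at the current point and does not increase on
average along the walk, so stopping at the first passage above `b` gives the bound. Here `c k` is
the level-`k` part of the position rescaled to steps in `X`, `e` collects null increments, `a` is
the budget already spent, and `m k` bounds the level-`k` steps still affordable: by `hm`, one more
would exceed the budget. -/
theorem mul_signProb_walkMax_le {E : Type*} [AddCommGroup E] [Module ℝ E] {N M : E → ℝ≥0∞}
    (hN0 : N 0 = 0) (hN : ∀ v w, N (v + w) ≤ N v + N w) (hneg : ∀ v, N (-v) = N v)
    (hsmul : ∀ (t : ℝ) v, 0 ≤ t → N (t • v) ≤ ENNReal.ofReal t * N v)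
    {V : ℝ≥0} (hNM : ∀ v, N v ≤ V * M v) {X : Set E} (hX : 0 ∈ X)
    (hMX : ∀ v (t : ℝ), 0 < t → M v < ENNReal.ofReal t → ∃ y ∈ X, v = t • y)
    {q : ℝ} (hq : 0 < q) {τ : ℕ → ℝ} (hτ : ∀ k, 0 < τ k)
    (hlev : ∀ r : ℝ≥0∞, r ≤ ENNReal.ofReal (τ 0) → r ≠ 0 →
      ∃ k, ENNReal.ofReal (τ k) ≤ r ∧ r < ENNReal.ofReal (2 * τ k))
    (b : ℝ≥0∞) (n : ℕ) (x : (i : ℕ) → (Fin i → ℤˣ) → E) (e : E) (he : N e = 0) (c : ℕ →₀ E)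
    (m : ℕ → ℕ) (a : ℝ≥0∞)
    (hm : ∀ k, ENNReal.ofReal (τ 0) ^ q < a + (m k + 1) * ENNReal.ofReal (τ k) ^ q) :
    b * signProb {ε | b < walkMax N n (e + c.sum fun k y => (2 * τ k) • y) x ε ∧
        a + walkSum (fun y => M y ^ q) n x ε ≤ ENNReal.ofReal (τ 0) ^ q} ≤
      ∑' k, ENNReal.ofReal (2 * τ k) * walkValue N X (m k) (c k) := by
  have hstart : ∀ (j : ℕ) (e : E) (c : ℕ →₀ E) (m : ℕ → ℕ), N e = 0 →
      b < N (e + c.sum fun k y => (2 * τ k) • y) → ∀ A : Set (Fin j → ℤˣ), b * signProb A ≤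
        ∑' k, ENNReal.ofReal (2 * τ k) * walkValue N X (m k) (c k) := by
    intro j e c m he hb A
    calc b * signProb A ≤ N (e + c.sum fun k y => (2 * τ k) • y) * 1 := by
          gcongr; exact signProb_le_one A
      _ ≤ N e + N (c.sum fun k y => (2 * τ k) • y) := by rw [mul_one]; exact hN _ _
      _ ≤ ∑' k, ENNReal.ofReal (2 * τ k) * N (c k) := by
        rw [he, zero_add]; exact apply_finsupp_sum_le hN0 hN hsmul hτ c
      _ ≤ _ := by
        refine ENNReal.tsum_le_tsum fun k => ?_
        gcongr
        exact le_walkValue N hX _ _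
  induction n generalizing x e c m a with
  | zero =>
    by_cases hb : b < N (e + c.sum fun k y => (2 * τ k) • y)
    · exact hstart 0 e c m he hb _
    rw [signProb_eq_zero fun ε h => hb h.1, mul_zero]
    exact zero_le
  | succ n ih =>
    by_cases hb : b < N (e + c.sum fun k y => (2 * τ k) • y)
    · exact hstart _ e c m he hb _
    set S : E := e + c.sum fun k y => (2 * τ k) • y with hS
    set s : ℝ≥0∞ := ENNReal.ofReal (τ 0) ^ q with hs
    -- If the first increment overruns the budget, the event is empty.
    by_cases hr : s < a + M (x 0 ![]) ^ q
    · rw [signProb_eq_zero, mul_zero]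
      · exact zero_le
      · rintro ε ⟨-, h⟩
        rw [walkSum, ← add_assoc] at h
        exact absurd (le_self_add.trans h) (not_le.2 hr)
    have hchild : ∀ σ : ℤˣ, signProb {ε : Fin n → ℤˣ | Fin.cons σ ε ∈
        {ε : Fin (n + 1) → ℤˣ | b < walkMax N (n + 1) S x ε ∧
          a + walkSum (fun y => M y ^ q) (n + 1) x ε ≤ s}} ≤
        signProb {ε : Fin n → ℤˣ | b < walkMax N n (S + σ • x 0 ![]) (treeShift x σ) ε ∧
          a + M (x 0 ![]) ^ q + walkSum (fun y => M y ^ q) n (treeShift x σ) ε ≤ s} := by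
      intro σ
      refine signProb_mono fun ε ⟨h1, h2⟩ => ⟨?_, ?_⟩
      · rw [walkMax_cons] at h1
        exact (lt_max_iff.1 h1).resolve_left hb
      · rwa [walkSum_cons, ← add_assoc] at h2
    have hsplit : ∀ f g : ℕ → ℝ≥0∞, (∀ k, (f k + g k) / 2 ≤ ENNReal.ofReal (2 * τ k) *
        walkValue N X (m k) (c k)) →
        b * signProb {ε : Fin n → ℤˣ | b < walkMax N n (S + x 0 ![]) (treeShift x 1) ε ∧
          a + M (x 0 ![]) ^ q + walkSum (fun y => M y ^ q) n (treeShift x 1) ε ≤ s} ≤ ∑' k, f k →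
        b * signProb {ε : Fin n → ℤˣ | b < walkMax N n (S - x 0 ![]) (treeShift x (-1)) ε ∧
          a + M (x 0 ![]) ^ q + walkSum (fun y => M y ^ q) n (treeShift x (-1)) ε ≤ s} ≤
            ∑' k, g k →
        b * signProb {ε : Fin (n + 1) → ℤˣ | b < walkMax N (n + 1) S x ε ∧
          a + walkSum (fun y => M y ^ q) (n + 1) x ε ≤ s} ≤
          ∑' k, ENNReal.ofReal (2 * τ k) * walkValue N X (m k) (c k) := by
      intro f g hfg hf hg
      have h1 := hchild 1
      have h2 := hchild (-1)
      rw [one_smul] at h1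
      rw [Units.neg_smul, one_smul, ← sub_eq_add_neg] at h2
      rw [signProb_succ, ← mul_div_assoc, mul_add]
      refine le_trans ?_ (ENNReal.tsum_le_tsum hfg)
      simp only [div_eq_mul_inv]
      rw [ENNReal.tsum_mul_right, ENNReal.tsum_add]
      gcongr
      · exact (mul_le_mul_right h1 b).trans hf
      · exact (mul_le_mul_right h2 b).trans hg
    rw [not_lt] at hr
    -- A null increment has no dyadic level; it goes into `e`, which N does not see.
    by_cases h0 : M (x 0 ![]) = 0
    · have hx0 : N (x 0 ![]) = 0 := by simpa [h0] using hNM (x 0 ![])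
      have hm' : ∀ k, s < a + M (x 0 ![]) ^ q + (m k + 1) * ENNReal.ofReal (τ k) ^ q := by
        rw [h0, ENNReal.zero_rpow_of_pos hq, add_zero]; exact hm
      refine hsplit _ _ (fun k => ?_)
        (le_trans (le_of_eq ?_) (ih (treeShift x 1) (e + x 0 ![]) ?_ c m _ hm'))
        (le_trans (le_of_eq ?_) (ih (treeShift x (-1)) (e - x 0 ![]) ?_ c m _ hm'))
      · rw [ENNReal.add_div, ENNReal.add_halves]
      · rw [hS, add_right_comm]
      · simpa [he, hx0] using hN e (x 0 ![])
      · rw [hS, add_sub_right_comm]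
      · simpa [he, hx0, hneg, ← sub_eq_add_neg] using hN e (-x 0 ![])
    · have hrτ : M (x 0 ![]) ≤ ENNReal.ofReal (τ 0) :=
        (ENNReal.rpow_le_rpow_iff hq).1 (le_add_self.trans hr)
      obtain ⟨k, hk1, hk2⟩ := hlev _ hrτ h0
      obtain ⟨y, hy, hxy⟩ := hMX _ _ (by have := hτ k; positivity) hk2
      have hk3 := ENNReal.rpow_le_rpow hk1 hq.le
      -- With `m k = 0`, `hm` would forbid any step of level `k`, yet this one fits in the budget.
      obtain ⟨j, hj⟩ : ∃ j, m k = j + 1 := by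
        refine Nat.exists_eq_succ_of_ne_zero fun hmk => ?_
        have := hm k
        rw [hmk, Nat.cast_zero, zero_add, one_mul] at this
        exact absurd (this.trans_le ((add_le_add le_rfl hk3).trans hr)) (lt_irrefl _)
      have hm' : ∀ i, s < a + M (x 0 ![]) ^ q +
          ((Function.update m k j i : ℕ) + 1) * ENNReal.ofReal (τ i) ^ q := by
        intro i
        by_cases hi : i = k
        · subst hi
          rw [Function.update_self]
          refine (hm i).trans_le ?_
          rw [hj, add_assoc]
          gcongr
          push_cast
          rw [add_mul _ 1, one_mul, add_comm]
          gcongr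
        · rw [Function.update_of_ne hi]
          refine (hm i).trans_le ?_
          gcongr
          exact le_self_add
      have hsum : ∀ z : E, (c + Finsupp.single k z).sum (fun k y => (2 * τ k) • y) =
          c.sum (fun k y => (2 * τ k) • y) + (2 * τ k) • z := by
        intro z
        rw [Finsupp.sum_add_index' (by simp) (by simp), Finsupp.sum_single_index (by simp)]
      refine hsplit _ _ (fun i => ?_)
        (le_trans (le_of_eq ?_) (ih (treeShift x 1) e he (c + Finsupp.single k y) _ _ hm'))
        (le_trans (le_of_eq ?_) (ih (treeShift x (-1)) e he (c + Finsupp.single k (-y)) _ _ hm'))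
      · by_cases hi : i = k
        · subst hi
          rw [Function.update_self, hj, ← mul_add, mul_div_assoc]
          gcongr
          simp only [Finsupp.add_apply, Finsupp.single_eq_same, ← sub_eq_add_neg]
          exact le_iSup₂ (f := fun z (_ : z ∈ X) =>
            (walkValue N X j (c i + z) + walkValue N X j (c i - z)) / 2) y hy
        · rw [Function.update_of_ne hi]
          simp only [Finsupp.add_apply, Finsupp.single_eq_of_ne hi, add_zero]
          rw [ENNReal.add_div, ENNReal.add_halves]
      · rw [hS, hsum, hxy, add_assoc]
      · rw [hS, hsum, hxy, smul_neg, ← sub_eq_add_neg, add_sub_assoc]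

theorem exists_dyadic_level {σ : ℝ} (hσ : 0 < σ) (r : ℝ≥0∞) (hr : r ≤ ENNReal.ofReal σ)
    (hr0 : r ≠ 0) : ∃ k : ℕ, ENNReal.ofReal (σ * (1 / 2) ^ k) ≤ r ∧
      r < ENNReal.ofReal (2 * (σ * (1 / 2) ^ k)) := by
  have hrt : r ≠ ∞ := ne_top_of_le_ne_top ENNReal.ofReal_ne_top hr
  have hpos : 0 < r.toReal := ENNReal.toReal_pos hr0 hrt
  have hle : r.toReal ≤ σ := ENNReal.toReal_le_of_le_ofReal hσ.le hr
  have hex : ∃ k : ℕ, σ * (1 / 2) ^ k ≤ r.toReal := by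
    obtain ⟨k, hk⟩ := exists_pow_lt_of_lt_one (div_pos hpos hσ) (by norm_num : (1 / 2 : ℝ) < 1)
    exact ⟨k, by rw [lt_div_iff₀ hσ] at hk; linarith⟩
  classical
  refine ⟨Nat.find hex, (ENNReal.ofReal_le_iff_le_toReal hrt).2 (Nat.find_spec hex), ?_⟩
  rw [ENNReal.lt_ofReal_iff_toReal_lt hrt]
  rcases hk : Nat.find hex with _ | j
  · simp only [pow_zero]; linarith
  · have := Nat.find_min hex (m := j) (by omega)
    rw [not_le] at this
    rw [pow_succ]; linarith

/-- The terms are dominated by a geometric series of ratio ρ = 2^(-(1 - q/p)), whose gap 1 - ρ is at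
least (p - q)/4. -/
theorem tsum_dyadic_le {p q : ℝ} (hp : p ≤ 2) (hq : 0 < q) (hqp : q < p) {σ : ℝ} (hσ : 0 < σ)
    (V : ℝ≥0) : ∑' k : ℕ, ENNReal.ofReal (2 * (σ * (1 / 2) ^ k)) *
      (V * ((⌊(2 : ℝ) ^ (k * q)⌋₊ : ℕ) : ℝ≥0∞) ^ (1 / p)) ≤
        ENNReal.ofReal (8 * σ * V / (p - q)) := by
  have hp0 : 0 < p := hq.trans hqp
  set u : ℝ := 1 - q / p with hu
  have hu0 : 0 ≤ u := by rw [hu, sub_nonneg, div_le_one hp0]; exact hqp.le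
  have hu1 : u ≤ 1 := by have : 0 < q / p := by positivity
                         linarith
  have hu2 : (p - q) / 2 ≤ u := by
    have : u = (p - q) / p := by rw [hu]; field_simp
    rw [this]
    exact div_le_div_of_nonneg_left (by linarith) hp0 hp
  set ρ : ℝ := (1 / 2 : ℝ) ^ u with hρ
  have hρ0 : 0 < ρ := by positivity
  have hρ1 : (p - q) / 4 ≤ 1 - ρ := by
    -- Bernoulli's inequality for exponents in [0, 1]: ρ ≤ 1 - u/2.
    have := rpow_one_add_le_one_add_mul_self (s := -(1 / 2)) (by norm_num) hu0 hu1
    rw [show (1 + -(1 / 2) : ℝ) = 1 / 2 by norm_num] at this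
    linarith
  have hterm : ∀ k : ℕ, ENNReal.ofReal (2 * (σ * (1 / 2) ^ k)) *
      (V * ((⌊(2 : ℝ) ^ (k * q)⌋₊ : ℕ) : ℝ≥0∞) ^ (1 / p)) ≤
      ENNReal.ofReal (2 * σ * V) * ENNReal.ofReal ρ ^ k := by
    intro k
    have h1 : ((⌊(2 : ℝ) ^ (k * q)⌋₊ : ℕ) : ℝ≥0∞) ^ (1 / p) ≤
        ENNReal.ofReal ((2 : ℝ) ^ (k * q / p)) := by
      rw [← ENNReal.ofReal_natCast, ENNReal.ofReal_rpow_of_nonneg (by positivity) (by positivity)]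
      apply ENNReal.ofReal_le_ofReal
      rw [div_eq_mul_one_div (k * q) p, Real.rpow_mul (by norm_num) (k * q)]
      exact Real.rpow_le_rpow (by positivity) (Nat.floor_le (by positivity)) (by positivity)
    refine (mul_le_mul_right (mul_le_mul_right h1 _) _).trans (le_of_eq ?_)
    rw [← ENNReal.ofReal_coe_nnreal, ← ENNReal.ofReal_mul (by positivity),
      ← ENNReal.ofReal_mul (by positivity), ← ENNReal.ofReal_pow hρ0.le,
      ← ENNReal.ofReal_mul (by positivity)]
    congr 1
    have h2 : ρ ^ k = (1 / 2) ^ k * (2 : ℝ) ^ (k * q / p) := by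
      rw [hρ, ← Real.rpow_natCast, ← Real.rpow_natCast, ← Real.rpow_mul (by norm_num), one_div,
        Real.inv_rpow (by norm_num), Real.inv_rpow (by norm_num), ← Real.rpow_neg (by norm_num),
        ← Real.rpow_neg (by norm_num), ← Real.rpow_add (by norm_num), hu]
      congr 1
      ring
    rw [h2]; ring
  refine (ENNReal.tsum_le_tsum hterm).trans ?_
  rw [ENNReal.tsum_mul_left, ENNReal.tsum_geometric, ← ENNReal.ofReal_one,
    ← ENNReal.ofReal_sub _ hρ0.le, ← ENNReal.ofReal_inv_of_pos (by linarith),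
    ← ENNReal.ofReal_mul (by positivity)]
  apply ENNReal.ofReal_le_ofReal
  have h3 : (1 - ρ)⁻¹ ≤ ((p - q) / 4)⁻¹ := inv_anti₀ (by linarith) hρ1
  calc 2 * σ * V * (1 - ρ)⁻¹ ≤ 2 * σ * V * ((p - q) / 4)⁻¹ := by gcongr
    _ = _ := by rw [inv_div]; ring

/-- Start the potential argument at the origin with levels σ 2^(-k). A budget σ^q pays for at most
⌊2^(kq)⌋ increments of size at least σ 2^(-k), and the rate hypothesis bounds each level. -/
theorem mul_signProb_walkMax_zero_le {E : Type*} [AddCommGroup E] [Module ℝ E] {N M : E → ℝ≥0∞}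
    (hN0 : N 0 = 0) (hN : ∀ v w, N (v + w) ≤ N v + N w) (hneg : ∀ v, N (-v) = N v)
    (hsmul : ∀ (t : ℝ) v, 0 ≤ t → N (t • v) ≤ ENNReal.ofReal t * N v)
    {V : ℝ≥0} (hNM : ∀ v, N v ≤ V * M v) {X : Set E} (hX : 0 ∈ X)
    (hMX : ∀ v (t : ℝ), 0 < t → M v < ENNReal.ofReal t → ∃ y ∈ X, v = t • y)
    {p q : ℝ} (hp : p ≤ 2) (hq : 0 < q) (hqp : q < p)
    (hV : ∀ m : ℕ, walkValue N X m 0 ≤ V * (m : ℝ≥0∞) ^ (1 / p)) {σ : ℝ} (hσ : 0 < σ)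
    (b : ℝ≥0∞) (n : ℕ) (x : (i : ℕ) → (Fin i → ℤˣ) → E) (a : ℝ≥0∞) :
    b * signProb {ε | b < walkMax N n 0 x ε ∧
        a + walkSum (fun y => M y ^ q) n x ε ≤ ENNReal.ofReal σ ^ q} ≤
      ENNReal.ofReal (8 * σ * V / (p - q)) := by
  have h := mul_signProb_walkMax_le hN0 hN hneg hsmul hNM hX hMX hq
    (τ := fun k => σ * (1 / 2) ^ k) (fun k => by positivity)
    (by simpa using exists_dyadic_level hσ) b n x 0 hN0 0 (fun k => ⌊(2 : ℝ) ^ (k * q)⌋₊) a ?_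
  · simp only [Finsupp.sum_zero_index, add_zero, pow_zero, mul_one, Finsupp.zero_apply] at h
    refine h.trans (le_trans ?_ (tsum_dyadic_le hp hq hqp hσ V))
    exact ENNReal.tsum_le_tsum fun k => mul_le_mul_right (hV _) _
  · intro k
    refine lt_of_lt_of_le ?_ le_add_self
    simp only [pow_zero, mul_one]
    have h1 : ((⌊(2 : ℝ) ^ (k * q)⌋₊ : ℕ) : ℝ≥0∞) + 1 =
        ENNReal.ofReal ((⌊(2 : ℝ) ^ (k * q)⌋₊ : ℕ) + 1) := by
      rw [ENNReal.ofReal_add (by positivity) (by positivity), ENNReal.ofReal_natCast,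
        ENNReal.ofReal_one]
    rw [h1, ENNReal.ofReal_rpow_of_pos hσ, ENNReal.ofReal_rpow_of_pos (by positivity),
      ← ENNReal.ofReal_mul (by positivity), ENNReal.ofReal_lt_ofReal_iff (by positivity),
      Real.mul_rpow hσ.le (by positivity)]
    have h2 : ((1 / 2 : ℝ) ^ k) ^ q = ((2 : ℝ) ^ (k * q))⁻¹ := by
      rw [← Real.rpow_natCast, ← Real.rpow_mul (by norm_num), one_div,
        Real.inv_rpow (by norm_num)]
    rw [h2]
    have h3 := Nat.lt_floor_add_one ((2 : ℝ) ^ (k * q))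
    have h4 : 0 < (2 : ℝ) ^ (k * q) := by positivity
    rw [mul_left_comm]
    refine lt_mul_of_one_lt_right (by positivity) ?_
    rw [← div_eq_mul_inv, one_lt_div h4]
    exact h3

/-! ### Good-λ for walks -/

/-- Restart the walk when it first exceeds `L`. The budget limits that jump, so N is then at most L
+ Vσ, and reaching 2L requires the restarted walk from 0 to exceed `b`. The weak-type bound `θ`
applies conditionally on the crossing. -/
theorem signProb_walkMax_good_lambda {E : Type*} [AddCommGroup E] {N M : E → ℝ≥0∞}
    (hN : ∀ v w, N (v + w) ≤ N v + N w) (hneg : ∀ v, N (-v) = N v)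
    {V : ℝ≥0} (hNM : ∀ v, N v ≤ V * M v) {q : ℝ} (hq : 0 < q) {L σ b θ : ℝ≥0∞}
    (hLσ : L + V * σ + b ≤ 2 * L)
    (hweak : ∀ (n : ℕ) (x : (i : ℕ) → (Fin i → ℤˣ) → E) (a : ℝ≥0∞),
      signProb {ε | b < walkMax N n 0 x ε ∧
        a + walkSum (fun y => M y ^ q) n x ε ≤ σ ^ q} ≤ θ)
    (n : ℕ) (v : E) (hv : N v ≤ L) (x : (i : ℕ) → (Fin i → ℤˣ) → E) (a : ℝ≥0∞) :
    signProb {ε | 2 * L < walkMax N n v x ε ∧ a + walkSum (fun y => M y ^ q) n x ε ≤ σ ^ q} ≤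
      θ * signProb {ε | L < walkMax N n v x ε} := by
  have hL2 : L ≤ 2 * L := le_mul_of_one_le_left zero_le (by norm_num)
  induction n generalizing v x a with
  | zero =>
    rw [signProb_eq_zero fun ε h => absurd (hv.trans hL2) (not_le.2 h.1)]
    exact zero_le
  | succ n ih =>
    have hchild : ∀ s : ℤˣ, signProb {ε : Fin n → ℤˣ | Fin.cons s ε ∈
        {ε : Fin (n + 1) → ℤˣ | 2 * L < walkMax N (n + 1) v x ε ∧
          a + walkSum (fun y => M y ^ q) (n + 1) x ε ≤ σ ^ q}} ≤
        θ * signProb {ε : Fin n → ℤˣ | Fin.cons s ε ∈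
          {ε : Fin (n + 1) → ℤˣ | L < walkMax N (n + 1) v x ε}} := by
      intro s
      have h1 : ∀ ε : Fin n → ℤˣ, Fin.cons s ε ∈
          {ε : Fin (n + 1) → ℤˣ | 2 * L < walkMax N (n + 1) v x ε ∧
            a + walkSum (fun y => M y ^ q) (n + 1) x ε ≤ σ ^ q} →
          2 * L < walkMax N n (v + s • x 0 ![]) (treeShift x s) ε ∧
            a + M (x 0 ![]) ^ q + walkSum (fun y => M y ^ q) n (treeShift x s) ε ≤ σ ^ q := by
        rintro ε ⟨h1, h2⟩
        rw [walkMax_cons] at h1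
        rw [walkSum_cons, ← add_assoc] at h2
        exact ⟨(lt_max_iff.1 h1).resolve_left (not_lt.2 (hv.trans hL2)), h2⟩
      by_cases hc : N (v + s • x 0 ![]) ≤ L
      · refine (signProb_mono h1).trans ((ih _ hc _ _).trans ?_)
        gcongr
        refine signProb_mono fun ε hε => ?_
        change L < walkMax N (n + 1) v x (Fin.cons s ε)
        rw [walkMax_cons]
        exact lt_max_of_lt_right hε
      · have hone : {ε : Fin n → ℤˣ | Fin.cons s ε ∈
            {ε : Fin (n + 1) → ℤˣ | L < walkMax N (n + 1) v x ε}} = Set.univ := by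
          refine Set.eq_univ_of_forall fun ε => ?_
          change L < walkMax N (n + 1) v x (Fin.cons s ε)
          rw [walkMax_cons]
          exact lt_max_of_lt_right ((not_le.1 hc).trans_le (le_walkMax _ _ _ _ _))
        rw [hone, signProb_univ, mul_one]
        refine le_trans (signProb_mono fun ε hε => ?_)
          (hweak n (treeShift x s) (a + M (x 0 ![]) ^ q))
        obtain ⟨h2, h3⟩ := h1 ε hε
        refine ⟨?_, h3⟩
        have hM : M (x 0 ![]) ≤ σ :=
          (ENNReal.rpow_le_rpow_iff hq).1 (le_add_self.trans (le_self_add.trans h3))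
        by_contra hb
        rw [not_lt] at hb
        refine absurd h2 (not_lt.2 ?_)
        -- Split the position after the crossing from the walk restarted at 0.
        rw [← add_zero (v + s • x 0 ![])]
        refine (walkMax_add_le hN _ _ _ _ _).trans (le_trans ?_ hLσ)
        gcongr
        refine (hN _ _).trans (add_le_add hv ?_)
        rw [apply_sign_smul hneg]
        exact (hNM _).trans (by gcongr)
    rw [signProb_succ, signProb_succ, ← mul_div_assoc, mul_add]
    gcongr
    · exact hchild 1
    · exact hchild (-1)

/-! ### The value of the linear game -/

section

variable {B : Type*} [AddCommGroup B] [Module ℝ B] [TopologicalSpace B]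

/-- The functional `sup_{w ∈ W} |⟨v, w⟩|`. -/
noncomputable def dualGauge (W : Set B) (v : StrongDual ℝ B) : ℝ≥0∞ := ⨆ w ∈ W, ‖v w‖ₑ

/-- Replacing the gauge by a supremum makes subadditivity immediate and matches the regret against
the best fixed point of `W`. -/
theorem egauge_polar (W : Set B) (v : StrongDual ℝ B) :
    egauge ℝ (StrongDual.polar ℝ W) v = dualGauge W v := by
  apply le_antisymm
  · refine ENNReal.le_of_forall_pos_le_add fun e he h => ?_
    set r : ℝ := (dualGauge W v).toReal + e with hr
    have hr0 : 0 < r := by have : 0 < (e : ℝ) := he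
                           positivity
    have hre : ENNReal.ofReal r = dualGauge W v + e := by
      rw [hr, ENNReal.ofReal_add ENNReal.toReal_nonneg e.coe_nonneg, ENNReal.ofReal_toReal h.ne,
        ENNReal.ofReal_coe_nnreal]
    rw [← hre, ← Real.enorm_eq_ofReal hr0.le]
    refine egauge_le_of_mem_smul ?_
    refine ⟨r⁻¹ • v, ?_, by simp [smul_smul, hr0.ne']⟩
    rw [StrongDual.mem_polar_iff]
    intro w hw
    have h1 : ‖v w‖ₑ ≤ ENNReal.ofReal r := by
      rw [hre]
      exact (le_iSup₂ (f := fun w (_ : w ∈ W) => ‖v w‖ₑ) w hw).trans le_self_add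
    rw [← ofReal_norm, ENNReal.ofReal_le_ofReal_iff hr0.le] at h1
    rw [smul_apply, norm_smul, norm_inv, Real.norm_of_nonneg hr0.le,
      inv_mul_le_iff₀ hr0, mul_one]
    exact h1
  · refine le_iInf₂ fun c hc => iSup₂_le fun w hw => ?_
    obtain ⟨y, hy, rfl⟩ := hc
    change ‖c • y w‖ₑ ≤ ‖c‖ₑ
    rw [enorm_smul]
    refine mul_le_of_le_one_right zero_le ?_
    have := (StrongDual.mem_polar_iff ℝ W).1 hy w hw
    rw [← ofReal_norm]
    exact ENNReal.ofReal_le_one.2 this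

theorem dualGauge_zero (W : Set B) : dualGauge W 0 = 0 := by simp [dualGauge]

theorem dualGauge_neg (W : Set B) (v : StrongDual ℝ B) : dualGauge W (-v) = dualGauge W v := by
  simp [dualGauge]

theorem dualGauge_smul_le (W : Set B) (t : ℝ) (v : StrongDual ℝ B) (ht : 0 ≤ t) :
    dualGauge W (t • v) ≤ ENNReal.ofReal t * dualGauge W v := by
  refine iSup₂_le fun w hw => ?_
  rw [smul_apply, enorm_smul, Real.enorm_eq_ofReal ht]
  gcongr
  exact le_iSup₂ (f := fun w (_ : w ∈ W) => ‖v w‖ₑ) w hw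

theorem dualGauge_add_le (W : Set B) (v v' : StrongDual ℝ B) :
    dualGauge W (v + v') ≤ dualGauge W v + dualGauge W v' := by
  refine iSup₂_le fun w hw => ?_
  refine (enorm_add_le (v w) (v' w)).trans ?_
  gcongr
  · exact le_iSup₂ (f := fun w (_ : w ∈ W) => ‖v w‖ₑ) w hw
  · exact le_iSup₂ (f := fun w (_ : w ∈ W) => ‖v' w‖ₑ) w hw

/-- The learner moves before the cost is revealed, so its losses on `x` and `-x` cancel on average,
and one of the two signs keeps the remaining target within reach. Here `s` is the sum of past costs
and `r` the regret still to be forced; the case `r < 0` is separate because `ENNReal.ofReal`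
truncates. -/
theorem exists_costs_of_lt_walkValue {W : Set B} {X : Set (StrongDual ℝ B)} (hW : W.Nonempty)
    (hWs : ∀ w ∈ W, -w ∈ W) (hX : X.Nonempty) (hXs : ∀ x ∈ X, -x ∈ X) (n : ℕ)
    (A : (m : ℕ) → (Fin m → linearCosts W X) → W) (s : StrongDual ℝ B) (r : ℝ)
    (hr : r < 0 ∨ ENNReal.ofReal r < walkValue (dualGauge W) X n s) :
    ∃ (f : Fin n → linearCosts W X) (w : W),
      r ≤ ∑ t : Fin n, (f t : W → ℝ) (A t (fun i => f (Fin.castLE t.isLt.le i))) -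
        (s w + ∑ t : Fin n, (f t : W → ℝ) w) := by
  induction n generalizing A s r with
  | zero =>
    have key : ∃ w : W, r ≤ |s w| := by
      rcases hr with hr | hr
      · obtain ⟨w, hw⟩ := hW
        exact ⟨⟨w, hw⟩, hr.le.trans (abs_nonneg _)⟩
      · obtain ⟨w, hw, h⟩ : ∃ w, ∃ _ : w ∈ W, ENNReal.ofReal r < ‖s w‖ₑ := by
          simpa only [walkValue, dualGauge, lt_iSup_iff] using hr
        refine ⟨⟨w, hw⟩, ?_⟩
        rw [← ofReal_norm] at h
        exact (ENNReal.ofReal_lt_ofReal_iff'.1 h).1.le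
    obtain ⟨w, hw⟩ := key
    refine ⟨Fin.elim0, ?_⟩
    rcases abs_cases (s w) with ⟨h, -⟩ | ⟨h, -⟩
    · exact ⟨⟨-w, hWs _ w.2⟩, by simpa [h] using hw⟩
    · exact ⟨w, by simpa [h] using hw⟩
  | succ n ih =>
    have step : ∀ x ∈ X, (r - x (A 0 Fin.elim0) < 0 ∨ ENNReal.ofReal (r - x (A 0 Fin.elim0)) <
        walkValue (dualGauge W) X n (s + x)) → ∃ (f : Fin (n + 1) → linearCosts W X) (w : W),
        r ≤ ∑ t : Fin (n + 1), (f t : W → ℝ) (A t (fun i => f (Fin.castLE t.isLt.le i))) -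
          (s w + ∑ t : Fin (n + 1), (f t : W → ℝ) w) := by
      intro x hx h
      let f₀ : linearCosts W X := ⟨fun w => x w, x, hx, rfl⟩
      -- After the first cost, the learner plays the algorithm that has `f₀` prepended to its
      -- history.
      obtain ⟨f, w, hf⟩ := ih (fun m h => A (m + 1) (Fin.cons f₀ h)) (s + x) _ h
      refine ⟨Fin.cons f₀ f, w, ?_⟩
      rw [Fin.sum_univ_succ, Fin.sum_univ_succ]
      have h0 : A (0 : Fin (n + 1)) (fun i => (Fin.cons f₀ f : Fin (n + 1) → linearCosts W X)
          (Fin.castLE (0 : Fin (n + 1)).isLt.le i)) = A 0 Fin.elim0 := by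
        congr 1
        exact funext fun j => absurd j.2 (by simp)
      have h1 : ∀ t : Fin n, A t.succ (fun i => (Fin.cons f₀ f : Fin (n + 1) → linearCosts W X)
          (Fin.castLE t.succ.isLt.le i)) =
            A (t + 1) (Fin.cons f₀ fun i => f (Fin.castLE t.isLt.le i)) := by
        intro t
        congr 1
        funext j
        refine Fin.cases ?_ (fun j => ?_) j <;> rfl
      rw [h0]
      simp only [h1, Fin.cons_zero, Fin.cons_succ]
      rw [add_apply] at hf
      change r ≤ x (A 0 Fin.elim0) + _ - (s w + (x w + _))
      linarith
    by_contra hcon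
    have hfail : ∀ x ∈ X, 0 ≤ r - x (A 0 Fin.elim0) ∧ walkValue (dualGauge W) X n (s + x) ≤
        ENNReal.ofReal (r - x (A 0 Fin.elim0)) := by
      intro x hx
      have := mt (step x hx) hcon
      rwa [not_or, not_lt, not_lt] at this
    have hsplit : ∃ x ∈ X, r < 0 ∨ ENNReal.ofReal r <
        (walkValue (dualGauge W) X n (s + x) + walkValue (dualGauge W) X n (s - x)) / 2 := by
      rcases hr with hr | hr
      · obtain ⟨x, hx⟩ := hX
        exact ⟨x, hx, Or.inl hr⟩
      · obtain ⟨x, hx, h⟩ := by simpa only [walkValue, lt_iSup_iff] using hr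
        exact ⟨x, hx, Or.inr h⟩
    obtain ⟨x, hx, h⟩ := hsplit
    obtain ⟨h1, h2⟩ := hfail x hx
    obtain ⟨h3, h4⟩ := hfail (-x) (hXs x hx)
    rw [neg_apply] at h3 h4
    rw [← sub_eq_add_neg] at h4
    rcases h with h | h
    · linarith
    · refine absurd h (not_lt.2 ?_)
      refine ENNReal.div_le_of_le_mul ((add_le_add h2 h4).trans (le_of_eq ?_))
      rw [← ENNReal.ofReal_add h1 h3, show (2 : ℝ≥0∞) = ENNReal.ofReal 2 by simp,
        ← ENNReal.ofReal_mul (by linarith)]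
      congr 1
      ring

theorem walkValue_le_of_gameValue_le {W : Set B} {X : Set (StrongDual ℝ B)} (hW : W.Nonempty)
    (hWs : ∀ w ∈ W, -w ∈ W) (hX : X.Nonempty) (hXs : ∀ x ∈ X, -x ∈ X) {p : ℝ}
    {V : ℝ≥0} (hV : ∀ n : ℕ, 1 ≤ n →
      gameValue (linearCosts W X) n ≤ (((V : ℝ) * (n : ℝ) ^ (-(1 - 1 / p)) : ℝ) : EReal)) (n : ℕ) :
    walkValue (dualGauge W) X n 0 ≤ V * (n : ℝ≥0∞) ^ (1 / p) := by
  rcases Nat.eq_zero_or_pos n with rfl | hn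
  · simp [walkValue, dualGauge_zero]
  have hn' : (0 : ℝ) < n := by exact_mod_cast hn
  have hconv : (V : ℝ≥0∞) * (n : ℝ≥0∞) ^ (1 / p) = ENNReal.ofReal (V * (n : ℝ) ^ (1 / p)) := by
    rw [ENNReal.ofReal_mul V.coe_nonneg, ENNReal.ofReal_coe_nnreal, ← ENNReal.ofReal_natCast,
      ENNReal.ofReal_rpow_of_pos hn']
  rw [hconv]
  by_contra hcon
  obtain ⟨r, hr0, hr1, hr2⟩ := ENNReal.lt_iff_exists_real_btwn.1 (not_le.1 hcon)
  have hlow : ((r / n : ℝ) : EReal) ≤ gameValue (linearCosts W X) n := by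
    refine le_iInf fun A => ?_
    obtain ⟨f, w, hf⟩ := exists_costs_of_lt_walkValue hW hWs hX hXs n A 0 r (Or.inr hr2)
    refine le_trans ?_ (le_iSup _ f)
    refine le_trans ?_ (EReal.sub_le_sub le_rfl (iInf_le _ w))
    rw [← EReal.coe_sub, EReal.coe_le_coe_iff, ← mul_sub, div_eq_mul_one_div, mul_comm]
    rw [zero_apply, zero_add] at hf
    gcongr
  have h1 := hlow.trans (hV n hn)
  -- Passing from average to total regret multiplies by n, so the exponent becomes 1/p.
  rw [EReal.coe_le_coe_iff, div_le_iff₀ hn', mul_assoc, ← Real.rpow_add_one hn'.ne'] at h1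
  rw [show -(1 - 1 / p) + 1 = 1 / p by ring] at h1
  exact absurd (ENNReal.ofReal_le_ofReal h1) (not_le.2 hr1)

end

/-! ### Moment bounds from the weak-type inequality -/

theorem signExpect_rpow_le_of_good_lambda {n : ℕ} {f g : (Fin n → ℤˣ) → ℝ≥0∞} {q δ : ℝ}
    (hq : 1 ≤ q) (hq2 : q ≤ 2) (hδ : 0 < δ) (hf : ∀ ε, f ε ≠ ∞) (hg : ∀ ε, g ε ≠ ∞)
    (H : ∀ t : ℝ, 0 < t → signProb {ε | 2 * ENNReal.ofReal t < f ε ∧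
      g ε ≤ ENNReal.ofReal (δ * t) ^ q} ≤
        ENNReal.ofReal (1 / 8) * signProb {ε | ENNReal.ofReal t < f ε}) :
    signExpect (fun ε => f ε ^ q) ≤ ENNReal.ofReal (4 / δ) ^ q * signExpect g := by
  have hq0 : 0 < q := by linarith
  let : MeasurableSpace (Fin n → ℤˣ) := ⊤
  -- `g` is already on the scale of q-th powers, hence the root.
  have key := lintegral_rpow_le_of_good_lambda (μ := signMeasure n) (f := fun ε => (f ε).toReal)
    (g := fun ε => (g ε ^ (1 / q)).toReal) (fun _ => ENNReal.toReal_nonneg)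
    (fun _ => ENNReal.toReal_nonneg) measurable_from_top measurable_from_top hq0 hδ
    (θ := ENNReal.ofReal (1 / 8)) ?_
  · rw [lintegral_signMeasure, lintegral_signMeasure, lintegral_signMeasure] at key
    have hA : ∀ ε, ENNReal.ofReal (((f ε).toReal / 2) ^ q) =
        ENNReal.ofReal ((1 / 2) ^ q) * f ε ^ q := by
      intro ε
      rw [div_eq_mul_one_div, mul_comm, Real.mul_rpow (by norm_num) ENNReal.toReal_nonneg,
        ENNReal.ofReal_mul (by positivity), ← ENNReal.ofReal_rpow_of_nonneg
          ENNReal.toReal_nonneg hq0.le, ENNReal.ofReal_toReal (hf ε)]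
    have hB : ∀ ε, ENNReal.ofReal ((f ε).toReal ^ q) = f ε ^ q := by
      intro ε
      rw [← ENNReal.ofReal_rpow_of_nonneg ENNReal.toReal_nonneg hq0.le,
        ENNReal.ofReal_toReal (hf ε)]
    have hC : ∀ ε, ENNReal.ofReal (((g ε ^ (1 / q)).toReal / δ) ^ q) =
        ENNReal.ofReal ((1 / δ) ^ q) * g ε := by
      intro ε
      rw [div_eq_mul_one_div, mul_comm, Real.mul_rpow (by positivity) ENNReal.toReal_nonneg,
        ENNReal.ofReal_mul (by positivity), ← ENNReal.ofReal_rpow_of_nonneg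
          ENNReal.toReal_nonneg hq0.le, ENNReal.ofReal_toReal
          (ENNReal.rpow_ne_top_of_nonneg (by positivity) (hg ε)), ← ENNReal.rpow_mul,
        one_div_mul_cancel hq0.ne', ENNReal.rpow_one]
    simp only [hA, hB, hC, signExpect_const_mul] at key
    set F := signExpect (fun ε => f ε ^ q) with hF
    have hFt : F ≠ ∞ := by
      rw [hF, signExpect]
      refine ENNReal.div_ne_top (ENNReal.sum_ne_top.2 fun ε _ =>
        ENNReal.rpow_ne_top_of_nonneg hq0.le (hf ε)) (by simp)
    have hG : signExpect g ≠ ∞ := by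
      rw [signExpect]
      exact ENNReal.div_ne_top (ENNReal.sum_ne_top.2 fun ε _ => hg ε) (by simp)
    rw [← ENNReal.ofReal_toReal hFt, ← ENNReal.ofReal_toReal hG] at key ⊢
    have hF0 : 0 ≤ F.toReal := ENNReal.toReal_nonneg
    have hG0 : 0 ≤ (signExpect g).toReal := ENNReal.toReal_nonneg
    generalize F.toReal = a at *
    generalize (signExpect g).toReal = c at *
    rw [← ENNReal.ofReal_mul (by positivity), ← ENNReal.ofReal_mul (by positivity),
      ← ENNReal.ofReal_mul (by positivity), ← ENNReal.ofReal_add (by positivity) (by positivity),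
      ENNReal.ofReal_le_ofReal_iff (by positivity)] at key
    rw [ENNReal.ofReal_rpow_of_pos (by positivity), ← ENNReal.ofReal_mul (by positivity)]
    apply ENNReal.ofReal_le_ofReal
    -- As q ≤ 2, the term a/8 is at most half of the left side and can be absorbed, `a` being
    -- finite.
    have h4 : (1 / 4 : ℝ) ≤ (1 / 2) ^ q := by
      calc (1 / 4 : ℝ) = (1 / 2) ^ (2 : ℝ) := by norm_num
        _ ≤ (1 / 2) ^ q := Real.rpow_le_rpow_of_exponent_ge (by norm_num) (by norm_num) hq2
    have h2 : (2 : ℝ) ≤ 2 ^ q := by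
      simpa using Real.rpow_le_rpow_of_exponent_le (by norm_num : (1 : ℝ) ≤ 2) hq
    have h5 : (1 / 2 : ℝ) ^ q * a ≤ 2 * ((1 / δ) ^ q * c) := by
      have := mul_le_mul_of_nonneg_right h4 hF0
      linarith
    have h6 : (2 : ℝ) ^ q * (1 / 2) ^ q = 1 := by
      rw [← Real.mul_rpow (by norm_num) (by norm_num)]; norm_num
    have h7 : (4 / δ) ^ q = 2 ^ q * 2 ^ q * (1 / δ) ^ q := by
      rw [← Real.mul_rpow (by norm_num) (by norm_num), ← Real.mul_rpow (by norm_num)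
        (by positivity)]
      congr 1
      ring
    have h8 : 0 ≤ (1 / δ) ^ q * c := by positivity
    calc a = 2 ^ q * ((1 / 2) ^ q * a) := by rw [← mul_assoc, h6, one_mul]
      _ ≤ 2 ^ q * (2 * ((1 / δ) ^ q * c)) := by gcongr
      _ ≤ 2 ^ q * (2 ^ q * ((1 / δ) ^ q * c)) := by gcongr
      _ = (4 / δ) ^ q * c := by rw [h7]; ring
  · intro t ht
    rw [signMeasure_apply, signMeasure_apply]
    have hlt : ∀ (r : ℝ) ε, 0 ≤ r → (r < (f ε).toReal ↔ ENNReal.ofReal r < f ε) :=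
      fun r ε hr => (ENNReal.ofReal_lt_iff_lt_toReal hr (hf ε)).symm
    refine le_trans (signProb_mono ?_) ((H t ht).trans ?_)
    · rintro ε ⟨h1, h2⟩
      refine ⟨?_, ?_⟩
      · have := (hlt _ ε (by positivity)).1 h1
        rwa [ENNReal.ofReal_mul (by norm_num), ENNReal.ofReal_ofNat] at this
      · rw [← ENNReal.le_ofReal_iff_toReal_le
          (ENNReal.rpow_ne_top_of_nonneg (by positivity) (hg ε)) (by positivity)] at h2
        have := ENNReal.rpow_le_rpow h2 hq0.le
        rwa [← ENNReal.rpow_mul, one_div_mul_cancel hq0.ne', ENNReal.rpow_one] at this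
    · gcongr
      refine signProb_mono fun ε h => ?_
      exact (hlt _ ε ht.le).2 h

theorem signExpect_rpow_walshPaley_le {E : Type*} [AddCommGroup E] [Module ℝ E]
    {N M : E → ℝ≥0∞}
    (hN0 : N 0 = 0) (hN : ∀ v w, N (v + w) ≤ N v + N w) (hneg : ∀ v, N (-v) = N v)
    (hsmul : ∀ (t : ℝ) v, 0 ≤ t → N (t • v) ≤ ENNReal.ofReal t * N v)
    {V : ℝ≥0} (hV0 : 0 < V) (hNM : ∀ v, N v ≤ V * M v) {X : Set E} (hX : 0 ∈ X)
    (hMX : ∀ v (t : ℝ), 0 < t → M v < ENNReal.ofReal t → ∃ y ∈ X, v = t • y)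
    {p q : ℝ} (hp : p ≤ 2) (hq : 1 ≤ q) (hqp : q < p)
    (hV : ∀ m : ℕ, walkValue N X m 0 ≤ V * (m : ℝ≥0∞) ^ (1 / p))
    (n : ℕ) (v : E) (x : (i : ℕ) → (Fin i → ℤˣ) → E) :
    signExpect (fun ε : Fin n → ℤˣ => N (walshPaley v x n ε) ^ q) ≤
      ENNReal.ofReal (512 * V / (p - q)) ^ q *
        (M v ^ q + signExpect (walkSum (fun y => M y ^ q) n x)) := by
  have hq0 : 0 < q := by linarith
  have hpq : 0 < p - q := by linarith
  have hVr : (0 : ℝ) < V := by exact_mod_cast hV0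
  have hsumE : M v ^ q + signExpect (walkSum (fun y => M y ^ q) n x) =
      signExpect (fun ε => M v ^ q + walkSum (fun y => M y ^ q) n x ε) := by
    rw [signExpect_add, signExpect_const]
  rw [hsumE]
  by_cases htop : signExpect (fun ε => M v ^ q + walkSum (fun y => M y ^ q) n x ε) = ∞
  · rw [htop, ENNReal.mul_top]
    · exact le_top
    · exact (ENNReal.rpow_pos (ENNReal.ofReal_pos.2 (by positivity)) ENNReal.ofReal_ne_top).ne'
  have hg := ne_top_of_signExpect_ne_top htop
  have hNv : N v ≠ ∞ := by
    refine ((hNM v).trans_lt (ENNReal.mul_lt_top ENNReal.coe_lt_top ?_)).ne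
    rw [lt_top_iff_ne_top]
    intro h
    refine hg 1 ?_
    rw [h, ENNReal.top_rpow_of_pos hq0, top_add]
  have hf : ∀ ε, walkMax N n v x ε ≠ ∞ := fun ε =>
    walkMax_ne_top hN hneg hNM hq0 n v hNv x ε (ENNReal.add_ne_top.1 (hg ε)).2
  -- With σ = δt and b = t/2, the weak-type bound 8σV/(p - q) equals b/8, which is the factor 1/8
  -- needed for absorption.
  set δ : ℝ := (p - q) / (128 * V) with hδ
  have hδ0 : 0 < δ := by positivity
  have hVδ : V * δ = (p - q) / 128 := by rw [hδ]; field_simp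
  have h4δ : 4 / δ = 512 * V / (p - q) := by rw [hδ]; field_simp; norm_num
  rw [← h4δ]
  refine (signExpect_mono fun ε => ENNReal.rpow_le_rpow
    (walshPaley_le_walkMax N n v x ε) hq0.le).trans ?_
  refine signExpect_rpow_le_of_good_lambda hq (by linarith) hδ0 hf hg fun t ht => ?_
  by_cases hvt : N v ≤ ENNReal.ofReal t
  · refine signProb_walkMax_good_lambda hN hneg hNM hq0 (b := ENNReal.ofReal (t / 2)) ?_ ?_
      n v hvt x (M v ^ q)
    · rw [← ENNReal.ofReal_coe_nnreal, ← ENNReal.ofReal_mul (by positivity),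
        ← ENNReal.ofReal_add (by positivity) (by positivity),
        ← ENNReal.ofReal_add (by positivity) (by positivity),
        show (2 : ℝ≥0∞) = ENNReal.ofReal 2 by simp, ← ENNReal.ofReal_mul (by norm_num)]
      apply ENNReal.ofReal_le_ofReal
      rw [← mul_assoc, hVδ]
      nlinarith
    · intro n x a
      have h := mul_signProb_walkMax_zero_le hN0 hN hneg hsmul hNM hX hMX hp hq0 hqp hV
        (σ := δ * t) (by positivity) (ENNReal.ofReal (t / 2)) n x a
      have h8 : 8 * (δ * t) * V / (p - q) = t / 2 * (1 / 8) := by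
        rw [show 8 * (δ * t) * V = 8 * t * (V * δ) by ring, hVδ]; field_simp; norm_num
      rw [h8, ENNReal.ofReal_mul (half_pos ht).le] at h
      exact (ENNReal.mul_le_mul_iff_right (ENNReal.ofReal_pos.2 (half_pos ht)).ne'
        ENNReal.ofReal_ne_top).1 h
  · rw [signProb_eq_zero]
    · exact zero_le
    · rintro ε ⟨-, h⟩
      refine hvt ((hNM v).trans ?_)
      have hM : M v ≤ ENNReal.ofReal (δ * t) :=
        (ENNReal.rpow_le_rpow_iff hq0).1 (le_self_add.trans h)
      refine (mul_le_mul_right hM _).trans ?_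
      rw [← ENNReal.ofReal_coe_nnreal, ← ENNReal.ofReal_mul (by positivity), ← mul_assoc, hVδ]
      apply ENNReal.ofReal_le_ofReal
      nlinarith

/-! ### From the value rate to martingale type -/

theorem exists_mem_smul_of_egauge_lt {E : Type*} [AddCommGroup E] [Module ℝ E] {X : Set E}
    (hc : Convex ℝ X) (hs : ∀ x ∈ X, -x ∈ X) {v : E} {t : ℝ} (ht : 0 < t)
    (h : egauge ℝ X v < ENNReal.ofReal t) : ∃ y ∈ X, v = t • y := by
  obtain ⟨c, hcv, hct⟩ := egauge_lt_iff.1 h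
  have hb : Balanced ℝ X := (balanced_iff_neg_mem hc).2 fun x hx => hs x hx
  have hle : ‖c‖ ≤ ‖t‖ := by
    rw [Real.norm_of_nonneg ht.le]
    rw [← ofReal_norm, ENNReal.ofReal_lt_ofReal_iff ht] at hct
    exact hct.le
  obtain ⟨y, hy, hyv⟩ := hb.smul_mono hle hcv
  exact ⟨y, hy, hyv.symm⟩

/-- Homogeneity extends the bound from `X`. Positivity of `V` matters where the gauge is infinite,
since 0 * ∞ = 0. -/
theorem dualGauge_le_mul_egauge {B : Type*} [AddCommGroup B] [Module ℝ B] [TopologicalSpace B]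
    {W : Set B} {X : Set (StrongDual ℝ B)} {V : ℝ≥0} (hV : 0 < V)
    (hX : ∀ x ∈ X, dualGauge W x ≤ V) (v : StrongDual ℝ B) :
    dualGauge W v ≤ V * egauge ℝ X v := by
  rw [mul_comm, ← ENNReal.div_le_iff (by exact_mod_cast hV.ne') ENNReal.coe_ne_top]
  refine le_iInf₂ fun c hc => ?_
  obtain ⟨y, hy, rfl⟩ := hc
  rw [ENNReal.div_le_iff (by exact_mod_cast hV.ne') ENNReal.coe_ne_top]
  refine iSup₂_le fun w hw => ?_
  change ‖c • y w‖ₑ ≤ _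
  rw [enorm_smul]
  gcongr
  exact (le_iSup₂ (f := fun w (_ : w ∈ W) => ‖y w‖ₑ) w hw).trans (hX y hy)

theorem martingaleTypeConst_le {E : Type*} [AddCommGroup E] [Module ℝ E] {K X : Set E} {q : ℝ}
    {C : ℝ≥0} (h : ∀ (n : ℕ) (v : E) (x : (i : ℕ) → (Fin i → ℤˣ) → E),
      signExpect (fun ε : Fin n → ℤˣ => egauge ℝ K (walshPaley v x n ε) ^ q) ≤
        (C : ℝ≥0∞) ^ q * (egauge ℝ X v ^ q +
          signExpect (walkSum (fun y => egauge ℝ X y ^ q) n x))) :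
    martingaleTypeConst K X q ≤ C := by
  refine iInf₂_le C fun v x => iSup_le fun n => (h n v x).trans ?_
  gcongr
  rw [signExpect_walkSum]
  exact ENNReal.sum_le_tsum _

theorem martingaleTypeConst_le_of_gameValue_le {B : Type*} [AddCommGroup B] [Module ℝ B]
    [TopologicalSpace B] {W : Set B} {X : Set (StrongDual ℝ B)}
    (hW : W.Nonempty) (hWs : ∀ w ∈ W, -w ∈ W) (hX : X.Nonempty) (hXc : Convex ℝ X)
    (hXs : ∀ x ∈ X, -x ∈ X) {p q : ℝ} (hp : p ≤ 2) (hq : 0 < q) (hqp : q < p) {V : ℝ≥0}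
    (hV0 : 0 < V) (hV : ∀ n : ℕ, 1 ≤ n →
      gameValue (linearCosts W X) n ≤ (((V : ℝ) * (n : ℝ) ^ (-(1 - 1 / p)) : ℝ) : EReal)) :
    martingaleTypeConst (StrongDual.polar ℝ W) X q ≤
      ENNReal.ofReal (1104 * V / (p - q) ^ 2) := by
  have hpq : 0 < p - q := by linarith
  have hVr : (0 : ℝ) < V := by exact_mod_cast hV0
  have hwv := walkValue_le_of_gameValue_le hW hWs hX hXs hV
  -- The one-round game alone bounds N on `X`.
  have hXV : ∀ x ∈ X, dualGauge W x ≤ V := by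
    intro x hx
    refine le_trans ?_ ((hwv 1).trans (by simp))
    refine le_trans ?_ (le_iSup₂ (f := fun z (_ : z ∈ X) =>
      (walkValue (dualGauge W) X 0 (0 + z) + walkValue (dualGauge W) X 0 (0 - z)) / 2) x hx)
    simp only [walkValue, zero_add, zero_sub, dualGauge_neg]
    rw [ENNReal.add_div, ENNReal.add_halves]
  have hNM := dualGauge_le_mul_egauge hV0 hXV
  rcases le_or_gt 1 q with hq1 | hq1
  · have hC : martingaleTypeConst (StrongDual.polar ℝ W) X q ≤
        ENNReal.ofReal (512 * V / (p - q)) := by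
      refine martingaleTypeConst_le fun n v x => ?_
      simp only [egauge_polar]
      exact signExpect_rpow_walshPaley_le (dualGauge_zero W) (dualGauge_add_le W)
        (dualGauge_neg W) (dualGauge_smul_le W) hV0 hNM (zero_mem_of_convex_symm hX hXc hXs)
        (fun v t ht h => exists_mem_smul_of_egauge_lt hXc hXs ht h) hp hq1 hqp hwv n v x
    refine hC.trans (ENNReal.ofReal_le_ofReal ?_)
    rw [div_le_div_iff₀ hpq (by positivity)]
    have h1 : 512 * (p - q) ≤ 1104 := by linarith
    calc 512 * V * (p - q) ^ 2 = 512 * (p - q) * (V * (p - q)) := by ring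
      _ ≤ 1104 * (V * (p - q)) := by gcongr
      _ = 1104 * V * (p - q) := by ring
  · have hC : martingaleTypeConst (StrongDual.polar ℝ W) X q ≤ V := by
      refine martingaleTypeConst_le fun n v x => ?_
      simp only [egauge_polar]
      refine (signExpect_mono fun ε => rpow_walshPaley_le (dualGauge_add_le W) (dualGauge_neg W)
        hNM hq hq1.le n v x ε).trans ?_
      rw [signExpect_add, signExpect_const, signExpect_const_mul, mul_add,
        ← ENNReal.mul_rpow_of_nonneg _ _ hq.le]
      gcongr
      exact hNM v
    refine hC.trans ?_
    rw [← ENNReal.ofReal_coe_nnreal]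
    apply ENNReal.ofReal_le_ofReal
    rw [le_div_iff₀ (by positivity), mul_comm]
    gcongr
    nlinarith

theorem mainTheorem6 {B : Type*} [AddCommGroup B] [Module ℝ B] [TopologicalSpace B]
    [IsTopologicalAddGroup B] [ContinuousSMul ℝ B]
    (W : Set B) (X : Set (StrongDual ℝ B))
    (hW_ne : W.Nonempty) (hW_conv : Convex ℝ W) (hW_symm : ∀ w ∈ W, -w ∈ W)
    (hX_ne : X.Nonempty) (hX_conv : Convex ℝ X) (hX_symm : ∀ x ∈ X, -x ∈ X)
    (p p' : ℝ) (hp : p ∈ Set.Icc (1 : ℝ) 2) (hp'_pos : 0 < p') (hp' : p' < p) :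
    martingaleTypeConst (StrongDual.polar ℝ W) X p' ≤
      1104 * valueRateConst W X p / ENNReal.ofReal ((p - p') ^ 2) := by
  have hpp : 0 < (p - p') ^ 2 := by have : 0 < p - p' := by linarith
                                    positivity
  set c : ℝ≥0∞ := 1104 / ENNReal.ofReal ((p - p') ^ 2) with hc
  have hc0 : c ≠ 0 := (ENNReal.div_pos (by norm_num) ENNReal.ofReal_ne_top).ne'
  have hct : c ≠ ∞ := ENNReal.div_ne_top (by norm_num) (ENNReal.ofReal_pos.2 hpp).ne'
  rw [ENNReal.mul_div_right_comm, ← hc, mul_comm, ← ENNReal.div_le_iff hc0 hct]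
  -- An admissible `V` may be 0; `V + e` is positive and still admissible.
  refine le_iInf₂ fun V hV => ENNReal.le_of_forall_pos_le_add fun e he _ => ?_
  rw [ENNReal.div_le_iff hc0 hct]
  have h := martingaleTypeConst_le_of_gameValue_le (V := V + e) hW_ne hW_symm hX_ne hX_conv
    hX_symm hp.2 hp'_pos hp' (by positivity) fun n hn => (hV n hn).trans (by
      rw [EReal.coe_le_coe_iff]
      gcongr
      exact le_self_add)
  refine h.trans (le_of_eq ?_)
  rw [ENNReal.ofReal_div_of_pos hpp, ENNReal.ofReal_mul (by norm_num), ENNReal.ofReal_coe_nnreal,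
    ENNReal.mul_div_right_comm, ENNReal.ofReal_ofNat, ← hc, mul_comm, ENNReal.coe_add]
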